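/- A weighted graph $G=(V,E,w)$ is a finite undirected simple graph on $n$ vertices with positive real edge weights. Let $\mathrm{dist}_G(u,v)\in[0,\infty]$ be the weighted shortest-path distance ($\infty$ if $u,v$ lie in different components), and let $\Lambda$ be the aspect ratio of $G$, the ratio of the largest finite distance to the smallest distance between distinct vertices (put $\log\Lambda:=0$ if $G$ has no edge). For a set $H$ of unordered pairs of distinct vertices (hops), let $G\cup H$ be $G$ with an additional edge of weight $\mathrm{dist}_G(x,y)$ for every $\{x,y\}\in H$ (parallel to the edge $\{x,y\}$ of $G$, if there is one). For real $\beta$ let $\mathrm{dist}^{(\beta)}_{G\cup H}(u,v)$ be the smallest length of a $u$-$v$ path in $G\cup H$ with at most $\beta$ edges ($\infty$ if there is none). $H$ is an $(\alpha,\beta)$ hopset of $G$ if $\mathrm{dist}_G(u,v)\le \mathrm{dist}^{(\beta)}_{G\cup H}(u,v)\le\alpha\cdot\mathrm{dist}_G(u,v)$ for all $u,v\in V$. There is an absolute constant $C>0$ such that for every real $0<\varepsilon<1/2$, every integer $k\ge 16^{1/\varepsilon}$ and every weighted graph $G$ on $n$ vertices the following hold. (1) There is a random set $H$ of pairs of distinct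 vertices that is always a $(9k^{\varepsilon},\,36^{1/\varepsilon}k^{1-\varepsilon})$ hopset of $G$ and satisfies $$\mathbb E|H|\le C\left(k^{\varepsilon}n^{1+1/k}+\frac{k^{\varepsilon}}{\varepsilon}\,n\right)\log\Lambda .$$ (2) For every integer $d\ge1$ there is a random set $H$ of pairs of distinct vertices with $$\mathbb E|H|\le C\left(k^{\varepsilon}n^{1+1/k}+\frac{k^{\varepsilon}}{\varepsilon}\,n\right)$$ such that, always, $\mathrm{dist}^{(36^{1/\varepsilon}k^{1-\varepsilon})}_{G\cup H}(u,v)\le 4.5\,k^{\varepsilon}d$ for all $u,v\in V$ with $d/2\le\mathrm{dist}_G(u,v)\le d$. -/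

import Mathlib

open scoped ENNReal NNReal

/-- The length of a walk: the sum of the weights of its edges, with multiplicity. -/
noncomputable def walkLength {V : Type*} {G : SimpleGraph V} (w : Sym2 V → ℝ≥0∞) {u v : V}
    (p : G.Walk u v) : ℝ≥0∞ :=
  (p.edges.map w).sum

/-- An undirected graph with positive real edge weights. The values of `weight` outside the edge
set are irrelevant. -/
structure WeightedGraph (V : Type*) where
  graph : SimpleGraph V
  weight : Sym2 V → ℝ≥0
  weight_pos : ∀ e ∈ graph.edgeSet, 0 < weight e

namespace WeightedGraph

/-- The weighted shortest-path distance; it is `⊤` between different components. -/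
noncomputable def dist {V : Type*} (G : WeightedGraph V) (u v : V) : ℝ≥0∞ :=
  ⨅ p : G.graph.Walk u v, walkLength (fun e => (G.weight e : ℝ≥0∞)) p

theorem dist_comm {V : Type*} (G : WeightedGraph V) (u v : V) : G.dist u v = G.dist v u := by
  have key : ∀ a b : V, G.dist a b ≤ G.dist b a := fun a b =>
    le_iInf fun p => (iInf_le _ p.reverse).trans
      (by simp [walkLength, SimpleGraph.Walk.edges_reverse, List.sum_reverse])
  exact le_antisymm (key u v) (key v u)

/-- The distance between the two endpoints of an unordered pair. -/
noncomputable def pairDist {V : Type*} (G : WeightedGraph V) (e : Sym2 V) : ℝ≥0∞ :=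
  Sym2.lift ⟨G.dist, G.dist_comm⟩ e

/-- The graph `G' = (V, E ∪ H)`. -/
def augment {V : Type*} (G : WeightedGraph V) (H : Finset (Sym2 V)) : SimpleGraph V :=
  G.graph ⊔ SimpleGraph.fromEdgeSet (H : Set (Sym2 V))

open Classical in
/-- The weights of `G' = (V, E ∪ H)`: a hop has the distance in `G` of its endpoints as weight, an
edge of `G` keeps its weight. A pair that is both a hop and an edge of `G` stands for two parallel
edges, of which the hop is never the longer one. -/
noncomputable def augmentWeight {V : Type*} (G : WeightedGraph V) (H : Finset (Sym2 V))
    (e : Sym2 V) : ℝ≥0∞ :=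
  if e ∈ H then G.pairDist e else (G.weight e : ℝ≥0∞)

/-- The length of a shortest walk in `G' = (V, E ∪ H)` from `u` to `v` that uses at most `β` edges
(`⊤` if there is none). -/
noncomputable def hopDist {V : Type*} (G : WeightedGraph V) (H : Finset (Sym2 V)) (β : ℝ)
    (u v : V) : ℝ≥0∞ :=
  ⨅ (p : (G.augment H).Walk u v) (_ : (p.length : ℝ) ≤ β), walkLength (G.augmentWeight H) p

/-- `H` is an `(α, β)` hopset of `G`. -/
def IsHopset {V : Type*} (G : WeightedGraph V) (α β : ℝ) (H : Finset (Sym2 V)) : Prop :=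
  (∀ e ∈ H, ¬ e.IsDiag) ∧
    ∀ u v : V, G.dist u v ≤ G.hopDist H β u v ∧
      G.hopDist H β u v ≤ ENNReal.ofReal α * G.dist u v

/-- The aspect ratio `Λ`: the largest finite distance divided by the smallest distance between two
distinct vertices. (It is `0`, so that `log Λ = 0`, if `G` has no edge.) -/
noncomputable def aspectRatio {V : Type*} (G : WeightedGraph V) : ℝ :=
  ((⨆ (u : V) (v : V) (_ : G.dist u v ≠ ⊤), G.dist u v) /
    (⨅ (u : V) (v : V) (_ : u ≠ v), G.dist u v)).toReal

end WeightedGraph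

/-- The expected number of pairs in a random finite set of vertex pairs. -/
noncomputable def expectedSize {V : Type*} (μ : PMF (Finset (Sym2 V))) : ℝ≥0∞ :=
  ∑' H : Finset (Sym2 V), μ H * (H.card : ℝ≥0∞)

/-! One deterministic set of hops serves all distances at once, so both random sets are point
masses.

The invariant is `ConnectedOrNear`: each pair at finite distance is joined by few edges with stretch
`a`, or both its ends are near a set `Z`. Two operations alternate. A phase (`exists_phase`) runs
`t` levels of a Thorup-Zwick hierarchy on `Z`: pairs in `Z` get two-edge connections, or both ends
are near a set `Z'` smaller by a factor `D ^ t`. The nearness constant thereby grows to order `t`.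
Subdivision (`ConnectedOrNear.subdivide`) brings it back to `4`: a shortest path is cut into order
`t` short pieces, and if one piece is not connected, its ends are near `Z'` relative to the piece
only. This multiplies the number of edges by order `t` but leaves the stretch alone.

With `n` vertices and `g = n ^ (1 / k)`, a set with `|Z| * g ^ σ ≤ n` allows `D = g ^ σ` at linear
cost per level, so `σ` is multiplied by `1 + t` in each phase. Only the first phase pays `n * g` per
level. Once the exponent reaches `k`, `Z` is empty and all pairs are connected.

Sampling is replaced by averaging (`exists_sample`). The factor `log Λ` matters only when `Λ < 2`;
then shortest paths are single edges and no hops are needed. -/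

namespace WeightedGraph

variable {V : Type*} (G : WeightedGraph V)

/-! ### Shortest paths -/

theorem dist_self (u : V) : G.dist u u = 0 :=
  le_antisymm ((iInf_le _ SimpleGraph.Walk.nil).trans (by simp [walkLength])) bot_le

theorem walkLength_append {V : Type*} {G : SimpleGraph V} (w : Sym2 V → ℝ≥0∞) {a b c : V}
    (p : G.Walk a b) (q : G.Walk b c) :
    walkLength w (p.append q) = walkLength w p + walkLength w q := by
  simp [walkLength, SimpleGraph.Walk.edges_append]

theorem walkLength_cons {V : Type*} {G : SimpleGraph V} (w : Sym2 V → ℝ≥0∞) {a b c : V}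
    (h : G.Adj a b) (q : G.Walk b c) :
    walkLength w (SimpleGraph.Walk.cons h q) = w s(a, b) + walkLength w q := by
  simp [walkLength]

theorem walkLength_nil {V : Type*} {G : SimpleGraph V} (w : Sym2 V → ℝ≥0∞) (a : V) :
    walkLength w (SimpleGraph.Walk.nil : G.Walk a a) = 0 := by
  simp [walkLength]

theorem dist_triangle (u v x : V) : G.dist u x ≤ G.dist u v + G.dist v x := by
  unfold dist
  rw [ENNReal.iInf_add]
  refine le_iInf fun p => ?_
  rw [ENNReal.add_iInf]
  refine le_iInf fun q => (iInf_le _ (p.append q)).trans ?_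
  rw [walkLength_append]

theorem dist_le_weight {u v : V} (h : G.graph.Adj u v) : G.dist u v ≤ G.weight s(u, v) :=
  (iInf_le _ (SimpleGraph.Walk.cons h .nil)).trans (by simp [walkLength])

theorem walkLength_bypass_le {V : Type*} [DecidableEq V] {G : SimpleGraph V} (w : Sym2 V → ℝ≥0∞)
    {u v : V} (p : G.Walk u v) : walkLength w p.bypass ≤ walkLength w p := by
  exact (p.edges_bypass_sublist_edges.map w).sum_le_sum (fun _ _ => bot_le)

/-- Bypassing cycles never lengthens a walk, and there are finitely many simple paths, so the
infimum is attained. -/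
theorem exists_geodesic [Fintype V] {u v : V} (h : G.dist u v ≠ ⊤) :
    ∃ p : G.graph.Walk u v, walkLength (fun e => (G.weight e : ℝ≥0∞)) p = G.dist u v := by
  classical
  have hne : Nonempty (G.graph.Walk u v) := by
    by_contra hc
    rw [not_nonempty_iff] at hc
    exact h (by simp [dist])
  obtain ⟨p₀⟩ := hne
  have : Nonempty (G.graph.Path u v) := ⟨p₀.toPath⟩
  obtain ⟨p, hp⟩ := Finite.exists_min
    (fun p : G.graph.Path u v => walkLength (fun e => (G.weight e : ℝ≥0∞)) (p : G.graph.Walk u v))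
  refine ⟨p, le_antisymm (le_iInf fun q => ?_) (iInf_le _ _)⟩
  exact (hp q.toPath).trans (walkLength_bypass_le _ q)

theorem dist_pos [Fintype V] {u v : V} (h : u ≠ v) : G.dist u v ≠ 0 := by
  intro h0
  obtain ⟨p, hp⟩ := G.exists_geodesic (u := u) (v := v) (by simp [h0])
  cases p with
  | nil => exact h rfl
  | cons hadj q =>
    rw [walkLength_cons, h0, add_eq_zero] at hp
    exact (G.weight_pos _ hadj).ne' (by simpa using hp.1)

/-! ### Walks with few edges in the augmented graph -/

/-- Some walk from `u` to `v` in `G ∪ H` with at most `b` edges has length at most `l`. -/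
def HopLE (H : Finset (Sym2 V)) (b : ℕ) (u v : V) (l : ℝ≥0∞) : Prop :=
  ∃ p : (G.augment H).Walk u v, p.length ≤ b ∧ walkLength (G.augmentWeight H) p ≤ l

variable {G} {H : Finset (Sym2 V)}

theorem HopLE.mono {b b' : ℕ} {u v : V} {l l' : ℝ≥0∞} (h : G.HopLE H b u v l)
    (hb : b ≤ b') (hl : l ≤ l') : G.HopLE H b' u v l' := by
  obtain ⟨p, h1, h2⟩ := h
  exact ⟨p, h1.trans hb, h2.trans hl⟩

theorem HopLE.trans {b b' : ℕ} {u v x : V} {l l' : ℝ≥0∞} (h : G.HopLE H b u v l)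
    (h' : G.HopLE H b' v x l') : G.HopLE H (b + b') u x (l + l') := by
  obtain ⟨p, h1, h2⟩ := h
  obtain ⟨q, h3, h4⟩ := h'
  refine ⟨p.append q, ?_, ?_⟩
  · rw [SimpleGraph.Walk.length_append]; omega
  · rw [walkLength_append]; gcongr

theorem HopLE.refl (u : V) : G.HopLE H 0 u u 0 :=
  ⟨.nil, by simp, by simp [walkLength]⟩

theorem HopLE.of_adj {u v : V} (h : G.graph.Adj u v) : G.HopLE H 1 u v (G.weight s(u, v)) := by
  refine ⟨SimpleGraph.Walk.cons (show (G.augment H).Adj u v from Or.inl h) .nil, by simp, ?_⟩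
  rw [walkLength_cons, walkLength_nil, add_zero, augmentWeight]
  split_ifs
  · exact G.dist_le_weight h
  · exact le_rfl

theorem HopLE.of_mem {u v : V} (h : u = v ∨ s(u, v) ∈ H) : G.HopLE H 1 u v (G.dist u v) := by
  rcases eq_or_ne u v with rfl | hne
  · exact (HopLE.refl u).mono (by simp) (by simp)
  · have hm := h.resolve_left hne
    refine ⟨SimpleGraph.Walk.cons (show (G.augment H).Adj u v from
      Or.inr ((SimpleGraph.fromEdgeSet_adj _).2 ⟨hm, hne⟩)) .nil, by simp, ?_⟩
    rw [walkLength_cons, walkLength_nil, add_zero, augmentWeight, if_pos hm]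
    exact le_rfl

theorem HopLE.symm {b : ℕ} {u v : V} {l : ℝ≥0∞} (h : G.HopLE H b u v l) : G.HopLE H b v u l := by
  obtain ⟨p, h1, h2⟩ := h
  refine ⟨p.reverse, by simpa using h1, ?_⟩
  simpa [walkLength, SimpleGraph.Walk.edges_reverse, List.sum_reverse] using h2

theorem HopLE.hopDist_le {b : ℕ} {β : ℝ} {u v : V} {l : ℝ≥0∞} (h : G.HopLE H b u v l)
    (hb : (b : ℝ) ≤ β) : G.hopDist H β u v ≤ l := by
  obtain ⟨p, h1, h2⟩ := h
  exact iInf_le_of_le p (iInf_le_of_le ((Nat.cast_le.2 h1).trans hb) h2)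

theorem dist_le_walkLength {u v : V} (p : (G.augment H).Walk u v) :
    G.dist u v ≤ walkLength (G.augmentWeight H) p := by
  induction p with
  | nil => simp [dist_self]
  | @cons a b c h p ih =>
    rw [walkLength_cons]
    refine (G.dist_triangle a b c).trans (add_le_add ?_ ih)
    rw [augmentWeight]
    split_ifs with hm
    · exact le_rfl
    · refine G.dist_le_weight (h.resolve_right fun h' => hm ?_)
      exact ((SimpleGraph.fromEdgeSet_adj _).1 h').1

theorem dist_le_hopDist (H : Finset (Sym2 V)) (β : ℝ) (u v : V) :
    G.dist u v ≤ G.hopDist H β u v :=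
  le_iInf₂ fun p _ => dist_le_walkLength p

/-- Either the pieces of length at most `r` into which a walk is cut can be traversed, or one of
them cannot. -/
theorem hopLE_or_exists_piece {a : ℕ} (ha : 1 ≤ a) (b : ℕ) (r : ℝ≥0∞) {u v : V}
    (p : G.graph.Walk u v) : ∀ (s : V) (M : ℕ), G.dist s u ≤ r →
      G.dist s u + walkLength (fun e => (G.weight e : ℝ≥0∞)) p ≤ M * r →
      G.HopLE H ((M + 1) * b + M) s v
        (a * (G.dist s u + walkLength (fun e => (G.weight e : ℝ≥0∞)) p)) ∨
      ∃ x y, G.dist x y ≤ r ∧ ¬ G.HopLE H b x y (a * G.dist x y) ∧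
        G.dist s x ≤ G.dist s u + walkLength (fun e => (G.weight e : ℝ≥0∞)) p ∧
        G.dist v y ≤ G.dist s u + walkLength (fun e => (G.weight e : ℝ≥0∞)) p := by
  -- `s` is the start of the current piece, `u` the vertex reached, and `M` bounds the number of
  -- cuts still to come.
  induction p with
  | @nil u =>
    intro s M hr hM
    by_cases hs : G.HopLE H b s u (a * G.dist s u)
    · left
      exact hs.mono (by nlinarith) (by simp [walkLength])
    · exact Or.inr ⟨s, u, hr, hs, by simp [dist_self], by simp [dist_self]⟩
  | @cons u u' v h p ih =>
    intro s M hr hM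
    rw [walkLength_cons] at hM ⊢
    set ω : ℝ≥0∞ := (G.weight s(u, u') : ℝ≥0∞)
    set l := walkLength (fun e => (G.weight e : ℝ≥0∞)) p
    have hstep : G.dist s u' ≤ G.dist s u + ω :=
      (G.dist_triangle s u u').trans (by gcongr; exact G.dist_le_weight h)
    have hvu : G.dist v u' ≤ l := by
      rw [dist_comm]; exact iInf_le _ p
    by_cases hr' : G.dist s u' ≤ r
    · have hle : G.dist s u' + l ≤ G.dist s u + (ω + l) := by
        rw [← add_assoc]; gcongr
      rcases ih s M hr' (hle.trans hM) with h1 | ⟨x, y, h1, h2, h3, h4⟩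
      · exact Or.inl (h1.mono le_rfl (by gcongr))
      · exact Or.inr ⟨x, y, h1, h2, h3.trans hle, h4.trans hle⟩
    · by_cases hs : G.HopLE H b s u (a * G.dist s u)
      -- The piece ends at `u` and the next edge is crossed on its own. Piece and edge together
      -- exceed `r`, which pays for lowering `M` by one.
      · have hlt : r < G.dist s u + ω := (not_le.1 hr').trans_le hstep
        have hrt : r ≠ ⊤ := hlt.ne_top
        obtain ⟨M, rfl⟩ : ∃ M', M = M' + 1 := by
          cases M with
          | zero =>
            exfalso
            rw [Nat.cast_zero, zero_mul, ← add_assoc] at hM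
            exact absurd (hlt.trans_le (le_self_add.trans hM)) not_lt_zero
          | succ M => exact ⟨M, rfl⟩
        have hl : l ≤ M * r := by
          rw [← add_assoc, Nat.cast_succ, add_mul, one_mul, add_comm (_ * r)] at hM
          have := (add_le_add_left hlt.le l).trans hM
          exact (ENNReal.add_le_add_iff_left hrt).1 this
        rcases ih u' M (by simp [dist_self]) (by simpa [dist_self] using hl) with
          h1 | ⟨x, y, h1, h2, h3, h4⟩
        · left
          refine ((hs.trans (HopLE.of_adj h)).trans h1).mono (by ring_nf; omega) ?_
          rw [dist_self, zero_add, add_assoc, mul_add, mul_add]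
          gcongr
          exact le_mul_of_one_le_left bot_le (by exact_mod_cast ha)
        · rw [dist_self, zero_add] at h3 h4
          refine Or.inr ⟨x, y, h1, h2, ?_, h4.trans (le_add_self.trans le_add_self)⟩
          refine (G.dist_triangle s u' x).trans ?_
          rw [← add_assoc]
          gcongr
      · refine Or.inr ⟨s, u, hr, hs, by simp [dist_self], ?_⟩
        refine (G.dist_triangle v u' u).trans ?_
        rw [dist_comm G u' u, add_comm]
        refine le_add_left ?_
        gcongr
        exact G.dist_le_weight h

end WeightedGraph

/-! ### Sampling by averaging -/

/-- The discrete form of comparing the sum with the integral of `x ^ M`; the inductive step is the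
first two terms of the binomial expansion. -/
theorem sum_range_pow_mul_le (m M : ℕ) :
    (∑ j ∈ Finset.range m, j ^ M) * (M + 1) ≤ m ^ (M + 1) := by
  induction m with
  | zero => simp
  | succ m ih =>
    rw [Finset.sum_range_succ, add_mul]
    refine (Nat.add_le_add_right ih _).trans ?_
    have h : ∀ N : ℕ, m ^ (N + 1) + m ^ N * (N + 1) ≤ (m + 1) ^ (N + 1) := by
      intro N
      induction N with
      | zero => simp
      | succ N ihN =>
        calc m ^ (N + 1 + 1) + m ^ (N + 1) * (N + 1 + 1)
            ≤ (m ^ (N + 1) + m ^ N * (N + 1)) * (m + 1) := by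
              have : 0 ≤ m ^ N * (N + 1) := Nat.zero_le _
              ring_nf; nlinarith
          _ ≤ (m + 1) ^ (N + 1) * (m + 1) := Nat.mul_le_mul_right _ ihN
          _ = _ := by ring
    exact h M

/-- If every point of a finite set is ranked by the number of points of at most its value, the
powers of the corank are dominated by the powers of the first numbers. -/
theorem sum_card_lt_pow_le {V R : Type*} [LinearOrder R] (A : Finset V) (f : V → R) (M : ℕ) :
    ∑ w ∈ A, (A.filter fun w' => f w < f w').card ^ M ≤ ∑ j ∈ Finset.range A.card, j ^ M := by
  classical
  induction hn : A.card generalizing A with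
  | zero =>
    rw [Finset.card_eq_zero] at hn
    simp [hn]
  | succ n ih =>
    obtain ⟨x, hx, hmin⟩ := A.exists_min_image f (Finset.card_pos.1 (by omega))
    have hc : (A.erase x).card = n := by rw [Finset.card_erase_of_mem hx]; omega
    rw [← Finset.add_sum_erase _ _ hx, Finset.sum_range_succ, add_comm]
    refine add_le_add ?_ ?_
    · refine le_trans (Finset.sum_le_sum fun w hw => ?_) (ih _ hc)
      refine Nat.pow_le_pow_left (Finset.card_le_card fun w' hw' => ?_) _
      rw [Finset.mem_filter] at hw' ⊢
      refine ⟨Finset.mem_erase.2 ⟨?_, hw'.1⟩, hw'.2⟩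
      rintro rfl
      exact absurd (hmin w (Finset.mem_of_mem_erase hw)) (not_le.2 hw'.2)
    · refine Nat.pow_le_pow_left ?_ _
      rw [← hc]
      refine Finset.card_le_card fun w' hw' => ?_
      rw [Finset.mem_filter] at hw'
      refine Finset.mem_erase.2 ⟨?_, hw'.1⟩
      rintro rfl
      exact lt_irrefl _ hw'.2

/-- A set `S` of at most `|A| / D` points such that on average at most `D` points of `A` are
strictly closer than `S`. -/
theorem exists_sample {V X R : Type*} [LinearOrder R] (A : Finset V) (B : Finset X)
    (f : X → V → R) {D : ℝ} (hD : 0 < D) :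
    ∃ S ⊆ A, (S.card : ℝ) * D ≤ A.card ∧
      ((∑ x ∈ B, (A.filter fun w => ∀ w' ∈ S, f x w < f x w').card : ℕ) : ℝ) ≤ B.card * D := by
  classical
  rcases A.eq_empty_or_nonempty with rfl | hA
  · exact ⟨∅, by simp, by simp, by simp; positivity⟩
  set m := A.card with hm
  have hm0 : 0 < m := Finset.card_pos.2 hA
  set M := ⌊(m : ℝ) / D⌋₊ with hM
  -- The average runs over all `M`-tuples in `A`. A point `w` is strictly closer than the whole
  -- tuple exactly when every entry lies among the points farther than `w`, which gives an `M`-th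
  -- power of a corank.
  let Ω : Finset (Fin M → V) := Fintype.piFinset fun _ => A
  have hΩ : Ω.card = m ^ M := by simp [Ω, Fintype.card_piFinset, hm]
  let cost : (Fin M → V) → ℕ := fun g =>
    ∑ x ∈ B, (A.filter fun w => ∀ w' ∈ Finset.univ.image g, f x w < f x w').card
  have htotal : (∑ g ∈ Ω, cost g) * (M + 1) ≤ B.card * m ^ (M + 1) := by
    have h1 : ∑ g ∈ Ω, cost g =
        ∑ x ∈ B, ∑ w ∈ A, (A.filter fun w' => f x w < f x w').card ^ M := by
      simp only [cost]
      rw [Finset.sum_comm]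
      refine Finset.sum_congr rfl fun x _ => ?_
      have hcount : ∀ w, (Ω.filter fun g => ∀ w' ∈ Finset.univ.image g, f x w < f x w') =
          Fintype.piFinset fun _ : Fin M => A.filter fun w' => f x w < f x w' := by
        intro w
        ext g
        simp [Ω, Fintype.mem_piFinset, forall_and]
      calc _ = ∑ g ∈ Ω, ∑ w ∈ A, if ∀ w' ∈ Finset.univ.image g, f x w < f x w' then 1 else 0 :=
            Finset.sum_congr rfl fun g _ => by rw [Finset.card_filter]
        _ = ∑ w ∈ A, ∑ g ∈ Ω, if ∀ w' ∈ Finset.univ.image g, f x w < f x w' then 1 else 0 :=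
            Finset.sum_comm
        _ = _ := Finset.sum_congr rfl fun w _ => by
            have hw := congrArg Finset.card (hcount w)
            rw [Finset.card_filter, Fintype.card_piFinset, Finset.prod_const, Finset.card_univ,
              Fintype.card_fin] at hw
            convert hw
    rw [h1, Finset.sum_mul]
    calc _ ≤ ∑ x ∈ B, m ^ (M + 1) := Finset.sum_le_sum fun x _ =>
          (Nat.mul_le_mul_right _ (sum_card_lt_pow_le A (f x) M)).trans (sum_range_pow_mul_le _ _)
      _ = _ := by simp
  obtain ⟨g, hg, hcost⟩ : ∃ g ∈ Ω, cost g * (M + 1) ≤ B.card * m := by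
    refine Finset.exists_le_of_sum_le (Finset.card_pos.1 (by rw [hΩ]; positivity)) ?_
    rw [← Finset.sum_mul, Finset.sum_const, hΩ, smul_eq_mul]
    exact htotal.trans (by ring_nf; rfl)
  refine ⟨Finset.univ.image g, ?_, ?_, ?_⟩
  · intro w hw
    obtain ⟨i, -, rfl⟩ := Finset.mem_image.1 hw
    exact Fintype.mem_piFinset.1 hg i
  · have h1 : ((Finset.univ.image g).card : ℝ) ≤ M := by
      have : (Finset.univ.image g).card ≤ M := Finset.card_image_le.trans_eq (by simp)
      exact Nat.cast_le.2 this
    have h2 : (M : ℝ) ≤ m / D := Nat.floor_le (by positivity)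
    exact (le_div_iff₀ hD).1 (h1.trans h2)
  · have h1 : (m : ℝ) / D < M + 1 := Nat.lt_floor_add_one _
    rw [div_lt_iff₀ hD] at h1
    have h2 : (cost g : ℝ) * (M + 1) ≤ B.card * m := by exact_mod_cast hcost
    have h3 : (cost g : ℝ) * (M + 1) ≤ (B.card * D) * (M + 1) := by
      refine h2.trans ?_
      have : (B.card : ℝ) * m ≤ B.card * ((M + 1) * D) := by gcongr
      linarith
    have h4 : (cost g : ℝ) ≤ B.card * D := le_of_mul_le_mul_right h3 (by positivity)
    convert h4

/-! ### One phase of the hierarchy: pivots and bunches -/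

namespace WeightedGraph

variable {V : Type*} (G : WeightedGraph V)

/-- Each point of `B` needs just one hop, to a nearest point of `A`. -/
theorem exists_pivots (B A : Finset V) :
    ∃ E : Finset (Sym2 V), (∀ e ∈ E, ¬ e.IsDiag) ∧ E.card ≤ B.card ∧
      ∀ x ∈ B, ∀ w ∈ A, ∃ w₀ ∈ A, G.dist x w₀ ≤ G.dist x w ∧ (x = w₀ ∨ s(x, w₀) ∈ E) := by
  classical
  rcases A.eq_empty_or_nonempty with rfl | hA
  · exact ⟨∅, by simp, by simp, by simp⟩
  choose p hp hmin using fun x => A.exists_min_image (G.dist x) hA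
  refine ⟨(B.image fun x => s(x, p x)).filter fun e => ¬ e.IsDiag,
    fun e he => (Finset.mem_filter.1 he).2,
    (Finset.card_filter_le _ _).trans Finset.card_image_le, fun x hx w hw => ?_⟩
  refine ⟨p x, hp x, hmin x w hw, or_iff_not_imp_left.2 fun hne => ?_⟩
  exact Finset.mem_filter.2 ⟨Finset.mem_image_of_mem _ hx, by simpa using hne⟩

/-- The bunch of `x` consists of the points of `A` strictly closer to `x` than all of `S`;
`exists_sample` bounds the total size of the bunches. -/
theorem exists_bunches (B A : Finset V) {D : ℝ} (hD : 0 < D) :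
    ∃ S ⊆ A, ∃ E : Finset (Sym2 V), (∀ e ∈ E, ¬ e.IsDiag) ∧ (S.card : ℝ) * D ≤ A.card ∧
      (E.card : ℝ) ≤ B.card * D ∧
      ∀ x ∈ B, ∀ w ∈ A, (x = w ∨ s(x, w) ∈ E) ∨ ∃ w' ∈ S, G.dist x w' ≤ G.dist x w := by
  classical
  obtain ⟨S, hSA, hS, hcost⟩ := exists_sample A B G.dist hD
  refine ⟨S, hSA, (B.biUnion fun x => (A.filter fun w => ∀ w' ∈ S, G.dist x w < G.dist x w').image
    fun w => s(x, w)).filter fun e => ¬ e.IsDiag, fun e he => (Finset.mem_filter.1 he).2, hS,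
    le_trans ?_ hcost, fun x hx w hw => ?_⟩
  · exact_mod_cast (Finset.card_filter_le _ _).trans (Finset.card_biUnion_le.trans
      (Finset.sum_le_sum fun x _ => Finset.card_image_le))
  · by_cases h : ∀ w' ∈ S, G.dist x w < G.dist x w'
    · refine Or.inl (or_iff_not_imp_left.2 fun hne => ?_)
      refine Finset.mem_filter.2 ⟨Finset.mem_biUnion.2 ⟨x, hx, ?_⟩, by simpa using hne⟩
      exact Finset.mem_image_of_mem _ (Finset.mem_filter.2 ⟨hw, h⟩)
    · push Not at h
      exact Or.inr h

/-- One phase of the construction, a truncated Thorup-Zwick hierarchy on `Z`. -/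
theorem exists_phase (Z : Finset V) {D : ℝ} (hD : 0 < D) (t : ℕ) :
    ∃ Z' ⊆ Z, ∃ E : Finset (Sym2 V), (∀ e ∈ E, ¬ e.IsDiag) ∧ (Z'.card : ℝ) * D ^ t ≤ Z.card ∧
      (E.card : ℝ) ≤ t * (Z.card * D + Z.card) ∧
      ∀ H : Finset (Sym2 V), E ⊆ H → ∀ x ∈ Z, ∀ y ∈ Z,
        (∃ j < t, G.HopLE H 2 x y ((2 * j + 1 : ℕ) * G.dist x y)) ∨
        ((∃ x' ∈ Z', G.dist x x' ≤ t * G.dist x y) ∧ ∃ y' ∈ Z', G.dist y y' ≤ t * G.dist x y) := by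
  classical
  induction t with
  | zero =>
    exact ⟨Z, subset_rfl, ∅, by simp, by simp, by simp, fun H _ x hx y hy =>
      Or.inr ⟨⟨x, hx, by simp [dist_self]⟩, ⟨y, hy, by simp [dist_self]⟩⟩⟩
  | succ t ih =>
    obtain ⟨A, hAZ, E, hE, hA, hEc, hgo⟩ := ih
    obtain ⟨S, hSA, E₁, hE₁, hS, hE₁c, hbunch⟩ := G.exists_bunches Z A hD
    obtain ⟨E₂, hE₂, hE₂c, hpivot⟩ := G.exists_pivots Z A
    refine ⟨S, hSA.trans hAZ, E ∪ (E₁ ∪ E₂), ?_, ?_, ?_, ?_⟩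
    · intro e he
      rcases Finset.mem_union.1 he with he | he
      · exact hE e he
      · exact (Finset.mem_union.1 he).elim (hE₁ e) (hE₂ e)
    · calc (S.card : ℝ) * D ^ (t + 1) = (S.card * D) * D ^ t := by ring
        _ ≤ A.card * D ^ t := by gcongr
        _ ≤ _ := hA
    · have h1 : ((E ∪ (E₁ ∪ E₂)).card : ℝ) ≤ E.card + (E₁.card + E₂.card) := by
        exact_mod_cast (Finset.card_union_le _ _).trans
          (Nat.add_le_add_left (Finset.card_union_le _ _) _)
      have h2 : (E₂.card : ℝ) ≤ Z.card := by exact_mod_cast hE₂c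
      push_cast
      linarith
    · intro H hH
      have hEH : E ⊆ H := Finset.subset_union_left.trans hH
      have hE₁H : E₁ ⊆ H :=
        (Finset.subset_union_left.trans Finset.subset_union_right).trans hH
      have hE₂H : E₂ ⊆ H :=
        (Finset.subset_union_right.trans Finset.subset_union_right).trans hH
      -- The pivot `w` of `x` is within `t + 1` times the distance of `y`. If it lies in the bunch
      -- of `y`, then `x`-`w`-`y` has stretch `t + (t + 1)`; otherwise `S` is that close to `y`.
      -- Using this in both directions keeps both ends near.
      have key : ∀ x ∈ Z, ∀ y ∈ Z, (∃ x' ∈ A, G.dist x x' ≤ t * G.dist x y) →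
          G.HopLE H 2 x y ((2 * t + 1 : ℕ) * G.dist x y) ∨
            ∃ y' ∈ S, G.dist y y' ≤ (t + 1 : ℕ) * G.dist x y := by
        rintro x hx y hy ⟨x', hx', hxx'⟩
        obtain ⟨w, hw, hxw, hhop⟩ := hpivot x hx x' hx'
        have h1 := hxw.trans hxx'
        have h2 : G.dist y w ≤ (t + 1 : ℕ) * G.dist x y := by
          refine (G.dist_triangle y x w).trans ?_
          rw [dist_comm G y x, Nat.cast_succ, add_mul, one_mul, add_comm]
          gcongr
        rcases hbunch y hy w hw with h | ⟨w', hw', hle⟩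
        · left
          have hop1 : G.HopLE H 1 x w (G.dist x w) := HopLE.of_mem (hhop.imp_right (@hE₂H _))
          have hop2 : G.HopLE H 1 y w (G.dist y w) := HopLE.of_mem (h.imp_right (@hE₁H _))
          refine (hop1.trans hop2.symm).mono le_rfl ((add_le_add h1 h2).trans (le_of_eq ?_))
          push_cast; ring
        · exact Or.inr ⟨w', hw', hle.trans h2⟩
      intro x hx y hy
      rcases hgo H hEH x hx y hy with ⟨j, hj, h⟩ | ⟨hx', hy'⟩
      · exact Or.inl ⟨j, by omega, h⟩
      · rw [dist_comm G x y] at hy'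
        rcases key x hx y hy hx' with h | h1
        · exact Or.inl ⟨t, by omega, h⟩
        rcases key y hy x hx hy' with h | h2
        · exact Or.inl ⟨t, by omega, by rw [dist_comm G x y]; exact h.symm⟩
        · rw [dist_comm G y x] at h2
          exact Or.inr ⟨h2, h1⟩

/-! ### Subdivision and phases for all vertices -/

/-- Every pair of vertices can be connected with `b` edges and stretch `a`, or both of its vertices
are close to `Z`. -/
def ConnectedOrNear (Z : Finset V) (E : Finset (Sym2 V)) (a b c : ℕ) : Prop :=
  ∀ H : Finset (Sym2 V), E ⊆ H → ∀ u v : V, G.dist u v ≠ ⊤ →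
    G.HopLE H b u v (a * G.dist u v) ∨
      ((∃ x ∈ Z, G.dist u x ≤ c * G.dist u v) ∧ ∃ y ∈ Z, G.dist v y ≤ c * G.dist u v)

variable {G}

/-- A piece has length at most `1 / M` of the distance, so nearness `c ≤ 3 * M` for a failing piece
costs at most `3` distances. Reaching the piece from either end costs at most one more. -/
theorem ConnectedOrNear.subdivide [Fintype V] {Z : Finset V} {E : Finset (Sym2 V)} {a b c M : ℕ}
    (h : G.ConnectedOrNear Z E a b c) (ha : 1 ≤ a) (hM : 1 ≤ M) (hc : c ≤ 3 * M) :
    G.ConnectedOrNear Z E a ((M + 1) * b + M) 4 := by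
  intro H hH u v huv
  obtain ⟨p, hp⟩ := G.exists_geodesic huv
  have hM0 : (M : ℝ≥0∞) ≠ 0 := by exact_mod_cast (by omega : M ≠ 0)
  have hMr : (M : ℝ≥0∞) * (G.dist u v / M) = G.dist u v :=
    ENNReal.mul_div_cancel hM0 (ENNReal.natCast_ne_top M)
  have := hopLE_or_exists_piece (H := H) ha b (G.dist u v / M) p u M (by simp [dist_self])
    (by rw [hp, dist_self, zero_add, hMr])
  rw [hp, dist_self, zero_add] at this
  refine this.imp_right ?_
  rintro ⟨x, y, hxy, hnot, hux, hvy⟩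
  have hxy' : G.dist x y ≠ ⊤ := (hxy.trans_lt (ENNReal.div_lt_top huv hM0)).ne
  obtain ⟨⟨z, hz, hxz⟩, z', hz', hyz'⟩ := (h H hH x y hxy').resolve_left hnot
  have hcd : c * G.dist x y ≤ 3 * G.dist u v := by
    calc (c : ℝ≥0∞) * G.dist x y ≤ (3 * M : ℕ) * (G.dist u v / M) := by gcongr
      _ = 3 * (M * (G.dist u v / M)) := by push_cast; ring
      _ = _ := by rw [hMr]
  have h4 : ((4 : ℕ) : ℝ≥0∞) * G.dist u v = G.dist u v + 3 * G.dist u v := by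
    push_cast; ring
  rw [h4]
  exact ⟨⟨z, hz, (G.dist_triangle u x z).trans (add_le_add hux (hxz.trans hcd))⟩,
    z', hz', (G.dist_triangle v y z').trans (add_le_add hvy (hyz'.trans hcd))⟩

/-- Vertices near `Z` first hop to pivots in `Z`, whose mutual distance is at most `4 + 1 + 4 = 9`
times the original. The phase on `Z` then acts on the pivots, and two outer hops plus two inner ones
explain `4 ≤ b`. -/
theorem ConnectedOrNear.exists_phase [Fintype V] {Z : Finset V} {E : Finset (Sym2 V)} {a b : ℕ}
    (h : G.ConnectedOrNear Z E a b 4) (hb : 4 ≤ b) {D : ℝ} (hD : 0 < D) (t : ℕ)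
    (ht : 18 * t ≤ a) (hE : ∀ e ∈ E, ¬ e.IsDiag) :
    ∃ Z' : Finset V, ∃ E' : Finset (Sym2 V), (∀ e ∈ E', ¬ e.IsDiag) ∧
      (Z'.card : ℝ) * D ^ t ≤ Z.card ∧
      (E'.card : ℝ) ≤ E.card + (t * (Z.card * D + Z.card) + Fintype.card V) ∧
      G.ConnectedOrNear Z' E' a b (9 * t + 4) := by
  classical
  obtain ⟨Z', -, E₁, hE₁, hZ', hE₁c, hgo⟩ := G.exists_phase Z hD t
  obtain ⟨E₂, hE₂, hE₂c, hpivot⟩ := G.exists_pivots Finset.univ Z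
  refine ⟨Z', E ∪ (E₁ ∪ E₂), ?_, hZ', ?_, ?_⟩
  · intro e he
    rcases Finset.mem_union.1 he with he | he
    · exact hE e he
    · exact (Finset.mem_union.1 he).elim (hE₁ e) (hE₂ e)
  · have h1 : ((E ∪ (E₁ ∪ E₂)).card : ℝ) ≤ E.card + (E₁.card + E₂.card) := by
      exact_mod_cast (Finset.card_union_le _ _).trans
        (Nat.add_le_add_left (Finset.card_union_le _ _) _)
    have h2 : (E₂.card : ℝ) ≤ Fintype.card V := by exact_mod_cast hE₂c
    linarith
  · intro H hH u v huv
    have hEH : E ⊆ H := Finset.subset_union_left.trans hH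
    have hE₁H : E₁ ⊆ H :=
      (Finset.subset_union_left.trans Finset.subset_union_right).trans hH
    have hE₂H : E₂ ⊆ H :=
      (Finset.subset_union_right.trans Finset.subset_union_right).trans hH
    rcases h H hEH u v huv with h | ⟨⟨x₀, hx₀, hux₀⟩, y₀, hy₀, hvy₀⟩
    · exact Or.inl h
    obtain ⟨x, hx, hux, hopx⟩ := hpivot u (Finset.mem_univ _) x₀ hx₀
    obtain ⟨y, hy, hvy, hopy⟩ := hpivot v (Finset.mem_univ _) y₀ hy₀
    replace hux := hux.trans hux₀
    replace hvy := hvy.trans hvy₀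
    have hxy : G.dist x y ≤ 9 * G.dist u v := by
      calc G.dist x y ≤ G.dist x u + (G.dist u v + G.dist v y) :=
            (G.dist_triangle x u y).trans (by gcongr; exact G.dist_triangle u v y)
        _ ≤ (4 : ℕ) * G.dist u v + (G.dist u v + (4 : ℕ) * G.dist u v) := by
            rw [dist_comm G x u]; gcongr
        _ = _ := by push_cast; ring
    rcases hgo H hE₁H x hx y hy with ⟨j, hj, hop⟩ | ⟨⟨x', hx', hxx'⟩, y', hy', hyy'⟩
    · left
      have hop1 : G.HopLE H 1 u x (G.dist u x) := HopLE.of_mem (hopx.imp_right (@hE₂H _))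
      have hop2 : G.HopLE H 1 v y (G.dist v y) := HopLE.of_mem (hopy.imp_right (@hE₂H _))
      refine ((hop1.trans hop).trans hop2.symm).mono hb ?_
      calc G.dist u x + (2 * j + 1 : ℕ) * G.dist x y + G.dist v y
          ≤ (4 : ℕ) * G.dist u v + (2 * j + 1 : ℕ) * (9 * G.dist u v)
            + (4 : ℕ) * G.dist u v := by gcongr
        _ = (4 + (2 * j + 1) * 9 + 4 : ℕ) * G.dist u v := by push_cast; ring
        -- Since `j ≤ t - 1`, the stretch is at most `8 + 9 * (2 * t - 1) = 18 * t - 1`.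
        _ ≤ a * G.dist u v := by gcongr; omega
    · right
      have hcast : ((9 * t + 4 : ℕ) : ℝ≥0∞) * G.dist u v =
          (4 : ℕ) * G.dist u v + t * (9 * G.dist u v) := by push_cast; ring
      rw [hcast]
      refine ⟨⟨x', hx', (G.dist_triangle u x x').trans ?_⟩, y', hy',
        (G.dist_triangle v y y').trans ?_⟩
      · exact add_le_add hux (hxx'.trans (by gcongr))
      · exact add_le_add hvy (hyy'.trans (by gcongr))

end WeightedGraph

/-! ### Iterating the phases -/

namespace WeightedGraph

variable {V : Type*} {G : WeightedGraph V}

/-- With `D = g ^ σ` a phase divides the size bound by `g ^ (σ * t)`, taking the exponent from `σ`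
to `σ * (1 + t)`. Subdividing with `M = 4 * t` is enough because `9 * t + 4 ≤ 12 * t` for `t ≥ 2`,
and it multiplies `b + 1` by exactly `4 * t + 1`. -/
theorem ConnectedOrNear.iterate [Fintype V] {Z : Finset V} {E : Finset (Sym2 V)} {a b t s : ℕ}
    {g : ℝ} (hg : 1 ≤ g) (h : G.ConnectedOrNear Z E a b 4) (hb : 4 ≤ b) (ht : 2 ≤ t)
    (hta : 18 * t ≤ a) (hE : ∀ e ∈ E, ¬ e.IsDiag)
    (hZ : (Z.card : ℝ) * (2 * g ^ s) ≤ Fintype.card V) (r : ℕ) :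
    ∃ Z' : Finset V, ∃ E' : Finset (Sym2 V), ∃ b' : ℕ, (∀ e ∈ E', ¬ e.IsDiag) ∧ 4 ≤ b' ∧
      b' + 1 = (b + 1) * (4 * t + 1) ^ r ∧
      (Z'.card : ℝ) * (2 * g ^ (s * (1 + t) ^ r)) ≤ Fintype.card V ∧
      (E'.card : ℝ) ≤ E.card + r * ((2 * t + 1) * Fintype.card V) ∧
      G.ConnectedOrNear Z' E' a b' 4 := by
  induction r with
  | zero => exact ⟨Z, E, b, hE, hb, by simp, by simpa using hZ, by simp, h⟩
  | succ r ih =>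
    obtain ⟨Z₁, E₁, b₁, hE₁, hb₁, hb₁', hZ₁, hE₁c, h₁⟩ := ih
    set σ := s * (1 + t) ^ r
    have hgσ : 1 ≤ g ^ σ := one_le_pow₀ hg
    obtain ⟨Z₂, E₂, hE₂, hZ₂, hE₂c, h₂⟩ :=
      h₁.exists_phase hb₁ (D := g ^ σ) (by positivity) t hta hE₁
    refine ⟨Z₂, E₂, (4 * t + 1) * b₁ + 4 * t, hE₂, ?_, ?_, ?_, ?_,
      h₂.subdivide (M := 4 * t) (by omega) (by omega) (by omega)⟩
    · nlinarith
    · rw [pow_succ, ← mul_assoc, ← hb₁']; ring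
    · calc (Z₂.card : ℝ) * (2 * g ^ (s * (1 + t) ^ (r + 1)))
          = (Z₂.card * (g ^ σ) ^ t) * (2 * g ^ σ) := by
            rw [← pow_mul, show s * (1 + t) ^ (r + 1) = σ * t + σ by simp only [σ]; ring, pow_add]
            ring
        _ ≤ Z₁.card * (2 * g ^ σ) := by gcongr
        _ ≤ _ := hZ₁
    · have h3 : (Z₁.card : ℝ) * g ^ σ ≤ Fintype.card V := by
        have : 0 ≤ (Z₁.card : ℝ) * g ^ σ := by positivity
        linarith
      have h4 : (Z₁.card : ℝ) ≤ Fintype.card V := by exact_mod_cast Z₁.card_le_univ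
      have h5 : (t : ℝ) * (Z₁.card * g ^ σ + Z₁.card) ≤
          t * (Fintype.card V + Fintype.card V) := by gcongr
      push_cast
      linarith

variable (G)

/-- The hopset in terms of its parameters: the numbers `t₀` and `t` of levels in the first and in
each of the `r + 1` other phases. -/
theorem exists_hops_of_params [Fintype V] {a t t₀ r k : ℕ} {g : ℝ} (hg : 1 ≤ g)
    (hgk : g ^ k = Fintype.card V) (ht : 2 ≤ t) (ht₀ : 1 ≤ t₀) (hk : k ≤ t₀ * (1 + t) ^ (r + 1))
    (hta : 18 * t ≤ a) (ht₀a : 2 * t₀ ≤ a + 1) :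
    ∃ H : Finset (Sym2 V), (∀ e ∈ H, ¬ e.IsDiag) ∧
      (H.card : ℝ) ≤ t₀ * (Fintype.card V * (2 * g) + Fintype.card V) +
        (r + 1) * ((2 * t + 1) * Fintype.card V) ∧
      ∀ u v, G.dist u v ≠ ⊤ →
        G.HopLE H (3 * (t₀ + 1) * (4 * t + 1) ^ r) u v (a * G.dist u v) := by
  obtain ⟨Z₁, -, E₁, hE₁, hZ₁, hE₁c, h₁⟩ := G.exists_phase Finset.univ (D := 2 * g) (by linarith) t₀
  have h₁' : G.ConnectedOrNear Z₁ E₁ a 2 t₀ := by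
    intro H hH u v _
    refine (h₁ H hH u (Finset.mem_univ _) v (Finset.mem_univ _)).imp_left ?_
    rintro ⟨j, hj, h⟩
    exact h.mono le_rfl (by gcongr; omega)
  -- Of the `2 ^ t₀` gained by `D = 2 * g` a single factor `2` is kept; it makes the last set empty
  -- rather than of size at most one.
  have hZ₁' : (Z₁.card : ℝ) * (2 * g ^ t₀) ≤ Fintype.card V := by
    refine le_trans ?_ hZ₁
    rw [mul_pow]
    gcongr
    exact le_self_pow₀ (by norm_num) (by omega)
  obtain ⟨Z₂, E₂, b, hE₂, hb, hb', hZ₂, hE₂c, h₂⟩ :=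
    (h₁'.subdivide (M := t₀) (by omega) ht₀ (by omega)).iterate hg (by omega) ht hta hE₁ hZ₁' r
  set σ := t₀ * (1 + t) ^ r
  have hgσ : 1 ≤ g ^ σ := one_le_pow₀ hg
  obtain ⟨Z₃, E₃, hE₃, hZ₃, hE₃c, h₃⟩ :=
    h₂.exists_phase hb (D := g ^ σ) (by positivity) t hta hE₂
  have hZ₃' : Z₃ = ∅ := by
    have h4 : (Z₃.card : ℝ) * (2 * g ^ (t₀ * (1 + t) ^ (r + 1))) ≤ g ^ k := by
      calc _ = (Z₃.card * (g ^ σ) ^ t) * (2 * g ^ σ) := by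
            rw [← pow_mul, show t₀ * (1 + t) ^ (r + 1) = σ * t + σ by simp only [σ]; ring, pow_add]
            ring
        _ ≤ Z₂.card * (2 * g ^ σ) := by gcongr
        _ ≤ _ := by rw [hgk]; exact hZ₂
    have h5 : (Z₃.card : ℝ) * (2 * g ^ k) ≤ 1 * g ^ k := by
      rw [one_mul]
      refine le_trans ?_ h4
      gcongr
    have h6 : (Z₃.card : ℝ) * 2 ≤ 1 := by
      rw [← mul_assoc] at h5
      exact le_of_mul_le_mul_right h5 (by positivity)
    have h7 : Z₃.card * 2 ≤ 1 := by exact_mod_cast h6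
    exact Finset.card_eq_zero.1 (by omega)
  refine ⟨E₃, hE₃, ?_, fun u v huv => ?_⟩
  · have h3 : (Z₂.card : ℝ) * g ^ σ ≤ Fintype.card V := by
      have : 0 ≤ (Z₂.card : ℝ) * g ^ σ := by positivity
      linarith
    have h4 : (Z₂.card : ℝ) ≤ Fintype.card V := by exact_mod_cast Z₂.card_le_univ
    have h5 : (t : ℝ) * (Z₂.card * g ^ σ + Z₂.card) ≤
        t * (Fintype.card V + Fintype.card V) := by gcongr
    rw [Finset.card_univ] at hE₁c
    linarith
  -- No subdivision follows the last phase: its nearness alternative is void.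
  · rcases h₃ E₃ subset_rfl u v huv with h | ⟨⟨x, hx, -⟩, -⟩
    · refine h.mono ?_ le_rfl
      rw [show 3 * (t₀ + 1) = (t₀ + 1) * 2 + t₀ + 1 by ring, ← hb']
      omega
    · simp [hZ₃'] at hx

/-! ### Choice of the parameters -/

/-- With `K = k ^ ε` and `X = K / 4`, take `t = ⌊X⌋`, so that `18 * t ≤ 4.5 * K`. The least `r` with
`k ≤ 2 * K * X ^ (r + 1)` puts `τ = k / X ^ (r + 1)` in `(8, 2 * K]`, and `t₀ = ⌈τ⌉`. -/
theorem exists_params {ε : ℝ} (hε : 0 < ε) (hε' : ε < 1 / 2) {k : ℕ}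
    (hk : (16 : ℝ) ^ (1 / ε) ≤ k) :
    ∃ a t t₀ r : ℕ, 2 ≤ t ∧ 1 ≤ t₀ ∧ k ≤ t₀ * (1 + t) ^ (r + 1) ∧ 18 * t ≤ a ∧ 2 * t₀ ≤ a + 1 ∧
      (a : ℝ) ≤ 4.5 * (k : ℝ) ^ ε ∧ (t₀ : ℝ) ≤ 2.25 * (k : ℝ) ^ ε ∧
      (r + 1 : ℝ) * (2 * t + 1) ≤ 2 * ((k : ℝ) ^ ε / ε) ∧
      ((3 * (t₀ + 1) * (4 * t + 1) ^ r : ℕ) : ℝ) ≤ (36 : ℝ) ^ (1 / ε) * (k : ℝ) ^ (1 - ε) := by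
  have hk1 : (1 : ℝ) ≤ k := (Real.one_le_rpow (by norm_num) (by positivity)).trans hk
  have hk0 : (0 : ℝ) < k := by linarith
  set K := (k : ℝ) ^ ε with hKdef
  have hK : 16 ≤ K := by
    have h := Real.rpow_le_rpow (by positivity) hk hε.le
    rwa [← Real.rpow_mul (by norm_num), one_div_mul_cancel hε.ne', Real.rpow_one] at h
  have hkK : (k : ℝ) = K ^ (1 / ε) := by
    rw [hKdef, ← Real.rpow_mul hk0.le, mul_one_div_cancel hε.ne', Real.rpow_one]
  -- This is where `ε < 1 / 2` enters; it excludes exponent `0` in the search for `r`.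
  have hK2 : 2 * K < k := by
    have h : K ^ (2 : ℕ) ≤ k := by
      rw [hKdef, ← Real.rpow_natCast, ← Real.rpow_mul hk0.le]
      calc (k : ℝ) ^ (ε * (2 : ℕ)) ≤ (k : ℝ) ^ (1 : ℝ) :=
            Real.rpow_le_rpow_of_exponent_le hk1 (by push_cast; linarith)
        _ = k := Real.rpow_one _
    nlinarith
  clear_value K
  set X := K / 4 with hX
  have hX4 : 4 ≤ X := by linarith
  have hex : ∃ q : ℕ, (k : ℝ) ≤ 2 * K * X ^ q := by
    obtain ⟨q, hq⟩ := pow_unbounded_of_one_lt (k : ℝ) (by linarith : 1 < X)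
    refine ⟨q, hq.le.trans (le_mul_of_one_le_left (by positivity) (by linarith))⟩
  classical
  obtain ⟨r, hr1, hr2⟩ : ∃ r : ℕ, (k : ℝ) ≤ 2 * K * X ^ (r + 1) ∧ 2 * K * X ^ r < k := by
    have hq := Nat.find_spec hex
    have hmin := fun m => Nat.find_min hex (m := m)
    generalize Nat.find hex = q at hq hmin
    cases q with
    | zero => rw [pow_zero, mul_one] at hq; linarith
    | succ r => exact ⟨r, hq, not_le.1 (hmin r (Nat.lt_succ_self r))⟩
  have hXr : 0 < X ^ r := by positivity
  have hXr1 : 0 < X ^ (r + 1) := by positivity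
  set τ := (k : ℝ) / X ^ (r + 1) with hτ
  have hτ1 : τ ≤ 2 * K := (div_le_iff₀ hXr1).2 hr1
  have hτ2 : 8 < τ := by
    rw [hτ, lt_div_iff₀ hXr1, pow_succ]
    have : 8 * (X ^ r * X) = 2 * K * X ^ r := by rw [hX]; ring
    linarith
  have hτk : τ * X ^ (r + 1) = k := div_mul_cancel₀ _ hXr1.ne'
  -- As `K ≥ 16`, `X ≥ √K`, hence `K ^ (1 + r / 2) ≤ 2 * K * X ^ r < k = K ^ (1 / ε)`.
  have hr : (1 : ℝ) + r / 2 < 1 / ε := by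
    have h1 : K ^ ((r : ℝ) / 2) ≤ X ^ r := by
      have h2 : K ^ ((1 : ℝ) / 2) ≤ X := by
        rw [← Real.sqrt_eq_rpow]
        exact Real.sqrt_le_iff.2 ⟨by linarith, by rw [hX]; nlinarith⟩
      calc K ^ ((r : ℝ) / 2) = (K ^ ((1 : ℝ) / 2)) ^ r := by
            rw [← Real.rpow_mul_natCast (by linarith)]; ring_nf
        _ ≤ X ^ r := by gcongr
    have h3 : K ^ ((1 : ℝ) + r / 2) < K ^ (1 / ε) := by
      rw [← hkK, Real.rpow_add (by linarith), Real.rpow_one]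
      refine lt_of_le_of_lt ?_ hr2
      have : 0 ≤ K * X ^ r := by positivity
      nlinarith
    exact (Real.rpow_lt_rpow_left_iff (by linarith)).1 h3
  set t := ⌊X⌋₊ with ht
  have htX : (t : ℝ) ≤ X := Nat.floor_le (by linarith)
  have htX' : X < t + 1 := Nat.lt_floor_add_one _
  set t₀ := ⌈τ⌉₊ with ht₀
  have ht₀τ : τ ≤ t₀ := Nat.le_ceil _
  have ht₀τ' : (t₀ : ℝ) < τ + 1 := Nat.ceil_lt_add_one (by linarith)
  refine ⟨⌊4.5 * K⌋₊, t, t₀, r, ?_, ?_, ?_, ?_, ?_, Nat.floor_le (by positivity), ?_, ?_, ?_⟩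
  · exact Nat.le_floor (by push_cast; linarith)
  · have : (1 : ℝ) ≤ t₀ := by linarith
    exact_mod_cast this
  · have : (k : ℝ) ≤ t₀ * (1 + t) ^ (r + 1) := by
      rw [← hτk]
      gcongr
      linarith
    exact_mod_cast this
  · refine Nat.le_floor ?_
    push_cast
    linarith
  · have : 2 * t₀ - 1 ≤ ⌊4.5 * K⌋₊ := by
      refine Nat.le_floor ?_
      rw [Nat.cast_sub]
      · push_cast; linarith
      · have : (1 : ℝ) ≤ t₀ := by linarith
        have : 1 ≤ t₀ := by exact_mod_cast this
        omega
    omega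
  · linarith
  · have h1 : (r + 1 : ℝ) ≤ 2 * (1 / ε) := by linarith
    have h2 : (2 * t + 1 : ℝ) ≤ K := by linarith
    calc (r + 1 : ℝ) * (2 * t + 1) ≤ 2 * (1 / ε) * K := by gcongr
      _ = _ := by ring
  · have h5 : 15 * (5 : ℝ) ^ r ≤ 36 ^ (1 / ε) := by
      have h6 : (5 : ℝ) ^ r ≤ 36 ^ ((r : ℝ) / 2) := by
        calc (5 : ℝ) ^ r ≤ 6 ^ r := by gcongr; norm_num
          _ = ((36 : ℝ) ^ ((1 : ℝ) / 2)) ^ r := by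
            rw [← Real.sqrt_eq_rpow, show (36 : ℝ) = 6 ^ 2 by norm_num,
              Real.sqrt_sq (by norm_num)]
          _ = _ := by rw [← Real.rpow_natCast, ← Real.rpow_mul (by norm_num)]; ring_nf
      have h7 : (36 : ℝ) * 36 ^ ((r : ℝ) / 2) ≤ 36 ^ (1 / ε) := by
        calc (36 : ℝ) * 36 ^ ((r : ℝ) / 2) = 36 ^ ((1 : ℝ) + r / 2) := by
              rw [Real.rpow_add (by norm_num), Real.rpow_one]
          _ ≤ _ := Real.rpow_le_rpow_of_exponent_le (by norm_num) hr.le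
      have h8 : (0 : ℝ) < 36 ^ ((r : ℝ) / 2) := by positivity
      linarith
    have hk' : (k : ℝ) ^ (1 - ε) = k / K := by
      rw [Real.rpow_sub hk0, Real.rpow_one, hKdef]
    push_cast
    -- `τ > 8` absorbs the rounding, `t₀ + 1 ≤ τ + 2 ≤ 1.25 * τ`, and `X ≥ 4` gives `4 * t + 1 ≤ 5 *
    -- X`.
    calc (3 : ℝ) * (t₀ + 1) * (4 * t + 1) ^ r ≤ 3 * (1.25 * τ) * (5 * X) ^ r := by
          gcongr
          · linarith
          · linarith
      _ = 15 * 5 ^ r * (τ * X ^ (r + 1) / K) := by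
          rw [mul_pow, pow_succ, hX]; field_simp; ring
      _ ≤ 36 ^ (1 / ε) * (k : ℝ) ^ (1 - ε) := by
          rw [hτk, hk']
          gcongr

/-- A set of hops for all distances at once. -/
theorem exists_hops [Fintype V] {ε : ℝ} (hε : 0 < ε) (hε' : ε < 1 / 2) {k : ℕ}
    (hk : (16 : ℝ) ^ (1 / ε) ≤ k) :
    ∃ H : Finset (Sym2 V), ∃ a b : ℕ, (∀ e ∈ H, ¬ e.IsDiag) ∧
      (H.card : ℝ) ≤ 7 * ((k : ℝ) ^ ε * (Fintype.card V : ℝ) ^ (1 + 1 / (k : ℝ))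
        + (k : ℝ) ^ ε / ε * (Fintype.card V : ℝ)) ∧
      (a : ℝ) ≤ 4.5 * (k : ℝ) ^ ε ∧ (b : ℝ) ≤ (36 : ℝ) ^ (1 / ε) * (k : ℝ) ^ (1 - ε) ∧
      ∀ u v, G.dist u v ≠ ⊤ → G.HopLE H b u v (a * G.dist u v) := by
  have hk1 : (1 : ℝ) ≤ k := (Real.one_le_rpow (by norm_num) (by positivity)).trans hk
  rcases isEmpty_or_nonempty V with hV | hV
  · exact ⟨∅, 0, 0, by simp, by simp; positivity, by simp; positivity, by simp; positivity,
      fun u => (hV.false u).elim⟩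
  obtain ⟨a, t, t₀, r, ht, ht₀, hkt, hta, ht₀a, ha, ht₀K, hr, hb⟩ := exists_params hε hε' hk
  have hn : (1 : ℝ) ≤ Fintype.card V := by exact_mod_cast Fintype.card_pos (α := V)
  set n : ℝ := (Fintype.card V : ℝ) with hndef
  set g : ℝ := n ^ (1 / (k : ℝ)) with hgdef
  have hg : 1 ≤ g := Real.one_le_rpow hn (by positivity)
  have hgk : g ^ k = n := by
    rw [hgdef, ← Real.rpow_natCast, ← Real.rpow_mul (by linarith),
      one_div_mul_cancel (by linarith), Real.rpow_one]
  obtain ⟨H, hH, hcard, hhop⟩ := G.exists_hops_of_params hg hgk ht ht₀ hkt hta ht₀a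
  refine ⟨H, a, _, hH, hcard.trans ?_, ha, hb, hhop⟩
  rw [← hndef]
  have hng : n ^ (1 + 1 / (k : ℝ)) = n * g := by
    rw [Real.rpow_add (by linarith), Real.rpow_one]
  rw [hng]
  have h1 : n * (2 * g) + n ≤ 3 * (n * g) := by nlinarith
  have h2 : (t₀ : ℝ) * (n * (2 * g) + n) ≤ (2.25 * (k : ℝ) ^ ε) * (3 * (n * g)) := by gcongr
  have h3 : (r + 1 : ℝ) * ((2 * t + 1) * n) ≤ 2 * ((k : ℝ) ^ ε / ε) * n := by
    rw [← mul_assoc]; gcongr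
  have h4 : 0 ≤ (k : ℝ) ^ ε * (n * g) := by positivity
  have h5 : 0 ≤ (k : ℝ) ^ ε / ε * n := by positivity
  linarith

/-! ### The aspect ratio -/

theorem iSup_dist_ne_top [Fintype V] :
    (⨆ (u : V) (v : V) (_ : G.dist u v ≠ ⊤), G.dist u v) ≠ ⊤ := by
  rcases isEmpty_or_nonempty {p : V × V // G.dist p.1 p.2 ≠ ⊤} with h | h
  · refine ne_top_of_le_ne_top ENNReal.zero_ne_top (iSup_le fun u => iSup₂_le fun v huv => ?_)
    exact (h.false ⟨(u, v), huv⟩).elim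
  · obtain ⟨p, hp⟩ := Finite.exists_max
      fun p : {p : V × V // G.dist p.1 p.2 ≠ ⊤} => G.dist p.1.1 p.1.2
    exact ne_top_of_le_ne_top p.2 (iSup_le fun u => iSup₂_le fun v huv => hp ⟨(u, v), huv⟩)

theorem iInf_dist_ne_zero [Fintype V] : (⨅ (u : V) (v : V) (_ : u ≠ v), G.dist u v) ≠ 0 := by
  rcases isEmpty_or_nonempty {p : V × V // p.1 ≠ p.2} with h | h
  · refine (lt_of_lt_of_le one_pos (le_iInf fun u => le_iInf₂ fun v huv => ?_)).ne'
    exact (h.false ⟨(u, v), huv⟩).elim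
  · obtain ⟨p, hp⟩ := Finite.exists_min
      fun p : {p : V × V // p.1 ≠ p.2} => G.dist p.1.1 p.1.2
    exact ((pos_iff_ne_zero.2 (G.dist_pos p.2)).trans_le
      (le_iInf fun u => le_iInf₂ fun v huv => hp ⟨(u, v), huv⟩)).ne'

/-- If some shortest path needs two edges, then the aspect ratio is at least two. -/
theorem hopLE_one_or_two_le_aspectRatio [Fintype V] (H : Finset (Sym2 V)) :
    (∀ u v, G.dist u v ≠ ⊤ → G.HopLE H 1 u v (G.dist u v)) ∨ 2 ≤ G.aspectRatio := by
  refine or_iff_not_imp_right.2 fun hΛ u v huv => ?_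
  obtain ⟨p, hp⟩ := G.exists_geodesic huv
  cases p with
  | nil => exact (HopLE.refl u).mono (by simp) (by simp)
  | @cons _ u' _ h q =>
    rw [walkLength_cons] at hp
    rcases eq_or_ne u' v with rfl | hne
    · exact (HopLE.of_adj h).mono le_rfl (le_self_add.trans hp.le)
    · exfalso
      apply hΛ
      -- Both the first edge and the rest of the shortest path join distinct vertices, so the path
      -- has length at least `2 * I`.
      set I := ⨅ (u : V) (v : V) (_ : u ≠ v), G.dist u v
      have hI : ∀ x y, x ≠ y → I ≤ G.dist x y := fun x y hxy =>
        iInf_le_of_le x (iInf₂_le_of_le y hxy le_rfl)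
      have hIt : I ≠ ⊤ := ne_top_of_le_ne_top huv
        ((hI _ _ h.ne).trans ((G.dist_le_weight h).trans (le_self_add.trans hp.le)))
      have h2 : 2 ≤ (⨆ (u : V) (v : V) (_ : G.dist u v ≠ ⊤), G.dist u v) / I := by
        rw [ENNReal.le_div_iff_mul_le (Or.inl G.iInf_dist_ne_zero) (Or.inl hIt)]
        calc 2 * I = I + I := two_mul I
          _ ≤ G.weight s(u, u') + walkLength (fun e => (G.weight e : ℝ≥0∞)) q :=
            add_le_add ((hI _ _ h.ne).trans (G.dist_le_weight h))
              ((hI _ _ hne).trans (iInf_le _ q))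
          _ = G.dist u v := hp
          _ ≤ _ := le_iSup_of_le u (le_iSup_of_le v
              (le_iSup (fun _ : G.dist u v ≠ ⊤ => G.dist u v) huv))
      have := ENNReal.toReal_mono
        (ENNReal.div_ne_top G.iSup_dist_ne_top G.iInf_dist_ne_zero) h2
      simpa [aspectRatio] using this

/-! ### Assembly -/

variable {G}

theorem isHopset_of_hopLE {H : Finset (Sym2 V)} (hH : ∀ e ∈ H, ¬ e.IsDiag) {a b : ℕ} {α β : ℝ}
    (hα : 0 < α) (ha : (a : ℝ) ≤ α) (hb : (b : ℝ) ≤ β)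
    (h : ∀ u v, G.dist u v ≠ ⊤ → G.HopLE H b u v (a * G.dist u v)) : G.IsHopset α β H := by
  refine ⟨hH, fun u v => ⟨dist_le_hopDist H β u v, ?_⟩⟩
  by_cases huv : G.dist u v = ⊤
  · rw [huv, ENNReal.mul_top (by simpa using hα)]
    exact le_top
  · refine ((h u v huv).hopDist_le hb).trans ?_
    gcongr
    rw [← ENNReal.ofReal_natCast]
    exact ENNReal.ofReal_le_ofReal ha

end WeightedGraph

theorem expectedSize_pure {V : Type*} (H : Finset (Sym2 V)) :
    expectedSize (PMF.pure H) = H.card := by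
  classical
  rw [expectedSize, tsum_eq_single H fun H' hH' => by simp [PMF.pure_apply, hH']]
  simp

theorem mainTheorem8 :
    ∃ C : ℝ, 0 < C ∧
      ∀ (ε : ℝ), 0 < ε → ε < 1 / 2 →
      ∀ (k : ℕ), (16 : ℝ) ^ (1 / ε) ≤ (k : ℝ) →
      ∀ (V : Type*) [Fintype V] (G : WeightedGraph V),
        (∃ μ : PMF (Finset (Sym2 V)),
          (∀ H ∈ μ.support,
            G.IsHopset (9 * (k : ℝ) ^ ε) ((36 : ℝ) ^ (1 / ε) * (k : ℝ) ^ (1 - ε)) H) ∧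
          expectedSize μ ≤ ENNReal.ofReal
            (C * (((k : ℝ) ^ ε * (Fintype.card V : ℝ) ^ (1 + 1 / (k : ℝ))
                + (k : ℝ) ^ ε / ε * (Fintype.card V : ℝ)) * Real.log G.aspectRatio))) ∧
        (∀ d : ℕ, 1 ≤ d →
          ∃ μ : PMF (Finset (Sym2 V)),
            (∀ H ∈ μ.support,
              (∀ e ∈ H, ¬ e.IsDiag) ∧
              ∀ u v : V, ENNReal.ofReal ((d : ℝ) / 2) ≤ G.dist u v →
                G.dist u v ≤ ENNReal.ofReal (d : ℝ) →
                G.hopDist H ((36 : ℝ) ^ (1 / ε) * (k : ℝ) ^ (1 - ε)) u v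
                  ≤ ENNReal.ofReal (4.5 * (k : ℝ) ^ ε * (d : ℝ))) ∧
            expectedSize μ ≤ ENNReal.ofReal
              (C * ((k : ℝ) ^ ε * (Fintype.card V : ℝ) ^ (1 + 1 / (k : ℝ))
                + (k : ℝ) ^ ε / ε * (Fintype.card V : ℝ)))) := by
  -- `7` from `exists_hops`, doubled because `log Λ ≥ 1 / 2` when `Λ ≥ 2`, fits under `20`.
  refine ⟨20, by norm_num, fun ε hε hε' k hk V _ G => ?_⟩
  have hk1 : (1 : ℝ) ≤ k := (Real.one_le_rpow (by norm_num) (by positivity)).trans hk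
  have hK1 : 1 ≤ (k : ℝ) ^ ε := Real.one_le_rpow hk1 hε.le
  obtain ⟨H, a, b, hH, hcard, ha, hb, hhop⟩ := G.exists_hops hε hε' hk
  set B := (k : ℝ) ^ ε * (Fintype.card V : ℝ) ^ (1 + 1 / (k : ℝ))
    + (k : ℝ) ^ ε / ε * (Fintype.card V : ℝ)
  have hB : 0 ≤ B := by positivity
  refine ⟨?_, fun d hd => ⟨PMF.pure H, ?_, ?_⟩⟩
  · rcases G.hopLE_one_or_two_le_aspectRatio ∅ with h1 | hΛ
    · refine ⟨PMF.pure ∅, ?_, by simp [expectedSize_pure]⟩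
      simp only [PMF.support_pure, Set.mem_singleton_iff, forall_eq]
      refine WeightedGraph.isHopset_of_hopLE (a := 1) (b := 1) (by simp) (by positivity)
        (by push_cast; linarith) ?_ (by simpa using h1)
      rw [Nat.cast_one]
      exact one_le_mul_of_one_le_of_one_le (Real.one_le_rpow (by norm_num) (by positivity))
        (Real.one_le_rpow hk1 (by linarith))
    · refine ⟨PMF.pure H, ?_, ?_⟩
      · simp only [PMF.support_pure, Set.mem_singleton_iff, forall_eq]
        exact WeightedGraph.isHopset_of_hopLE hH (by positivity) (by linarith) hb hhop
      · rw [expectedSize_pure, ← ENNReal.ofReal_natCast]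
        refine ENNReal.ofReal_le_ofReal (hcard.trans ?_)
        have hlog : (1 / 2 : ℝ) ≤ Real.log G.aspectRatio :=
          (by linarith [Real.log_two_gt_d9] : (1 / 2 : ℝ) ≤ Real.log 2).trans
            (Real.log_le_log (by norm_num) hΛ)
        have : B * (1 / 2) ≤ B * Real.log G.aspectRatio := by gcongr
        linarith
  · simp only [PMF.support_pure, Set.mem_singleton_iff, forall_eq]
    refine ⟨hH, fun u v _ huv => ?_⟩
    refine ((hhop u v (ne_top_of_le_ne_top ENNReal.ofReal_ne_top huv)).hopDist_le hb).trans ?_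
    rw [ENNReal.ofReal_mul (by positivity), ← ENNReal.ofReal_natCast]
    gcongr
  · rw [expectedSize_pure, ← ENNReal.ofReal_natCast]
    exact ENNReal.ofReal_le_ofReal (by linarith)
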